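/- A family $\mathcal H$ of (pairwise distinct) subsets of a set $X$ is an $\omega$-fold cover of $X$ if every point of $X$ belongs to infinitely many members of $\mathcal H$. It can be partitioned into two subcovers if $\mathcal H=\mathcal A\cup\mathcal B$ for disjoint subfamilies $\mathcal A,\mathcal B$ with $\bigcup\mathcal A=\bigcup\mathcal B=X$. The following holds in ZFC. Let $X$ be the real line $\mathbb R$, the Baire space $\omega^\omega$, or the Cantor space $2^\omega$ (the last two being countable powers of the discrete spaces $\omega$ and $2=\{0,1\}$, with the product topology). Then there is an $\omega$-fold cover of $X$ by closed sets which cannot be partitioned into two subcovers. Moreover, for $X=\mathbb R$ there is such a cover and a compact set $K\subseteq\mathbb R$ such that every member of the cover is a translate $K+t$ $(t\in\mathbb R)$ of $K$. -/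

import Mathlib

/-- The family `𝓗` of subsets of `X` is a cover of `X`: every point lies in some member. -/
def IsCover {X : Type*} (𝓗 : Set (Set X)) : Prop :=
  ∀ x : X, ∃ H ∈ 𝓗, x ∈ H

/-- The family `𝓗` is a `κ`-fold (simple) cover of `X`: every point of `X` lies in at least `κ`
distinct members of `𝓗`. -/
def IsFoldCover {X : Type*} (κ : Cardinal) (𝓗 : Set (Set X)) : Prop :=
  ∀ x : X, κ ≤ Cardinal.mk {H : Set X // H ∈ 𝓗 ∧ x ∈ H}

/-- `𝓗` can be partitioned into two subcovers, i.e. it is the union of two disjoint subfamilies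
each of which is a cover of `X`. -/
def SplitsIntoTwoCovers {X : Type*} (𝓗 : Set (Set X)) : Prop :=
  ∃ 𝓐 𝓑 : Set (Set X), 𝓐 ∪ 𝓑 = 𝓗 ∧ Disjoint 𝓐 𝓑 ∧ IsCover 𝓐 ∧ IsCover 𝓑

/-- `𝓗` is an `ω`-fold cover of `X` by closed sets that cannot be partitioned into two
subcovers. -/
def IsUnsplittableOmegaFoldClosedCover {X : Type*} [TopologicalSpace X]
    (𝓗 : Set (Set X)) : Prop :=
  (∀ H ∈ 𝓗, IsClosed H) ∧ IsFoldCover Cardinal.aleph0 𝓗 ∧ ¬ SplitsIntoTwoCovers 𝓗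

/-! Call `{n | p ∈ H n}` the trace of `p`. If every infinite set of indices is the trace of a point
of `P`, and the other members miss `P`, no splitting works: one class contains infinitely many `H
n`, and a point of `P` whose trace is exactly those indices is missed by the other class. Infinite
traces on `P` give multiplicity there; the extra sets give it off `P`. In a power of a discrete
space, `H n` is `{f | f n ≠ a}`. On the line, `K` is the set of decimals with digits 0 and 1, `H n`
is `K + 10⁻ⁿ`, and `P` is the part of `K` with infinitely many ones. Sums of a few such decimals
never carry, so `H n` cuts out of `K` the points with `n`-th digit 1. The hard part is
`infinite_setOf_translates_avoiding`, which supplies the extra translates. -/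

/-- Sets `H n` whose traces on `P` realize every infinite set of indices, together with enough
closed sets missing `P`, form an unsplittable `ω`-fold closed cover. -/
theorem isUnsplittableOmegaFoldClosedCover_range_union {X : Type*} [TopologicalSpace X]
    {H : ℕ → Set X} {𝓝 : Set (Set X)} {P : Set X}
    (hH : ∀ n, IsClosed (H n)) (hN : ∀ N ∈ 𝓝, IsClosed N)
    (hPN : ∀ N ∈ 𝓝, Disjoint N P)
    (hsurj : ∀ S : Set ℕ, S.Infinite → ∃ p ∈ P, ∀ n, p ∈ H n ↔ n ∈ S)
    (hP : ∀ p ∈ P, {n | p ∈ H n}.Infinite)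
    (hPc : ∀ x ∉ P, {N | N ∈ 𝓝 ∧ x ∈ N}.Infinite) :
    IsUnsplittableOmegaFoldClosedCover (Set.range H ∪ 𝓝) := by
  have hinj : Function.Injective H := by
    intro m n hmn
    by_contra hne
    obtain ⟨p, -, hp⟩ := hsurj {n}ᶜ (Set.finite_singleton n).infinite_compl
    have h1 := (hp m).2 hne
    rw [hmn, hp n] at h1
    exact h1 rfl
  refine ⟨?_, ?_, ?_⟩
  · rintro _ (⟨n, rfl⟩ | h)
    exacts [hH n, hN _ h]
  · intro x
    rw [Cardinal.aleph0_le_mk_iff]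
    refine Set.Infinite.to_subtype (s := {N | N ∈ Set.range H ∪ 𝓝 ∧ x ∈ N}) ?_
    by_cases hx : x ∈ P
    · refine ((hP x hx).image hinj.injOn).mono ?_
      rintro _ ⟨n, hn, rfl⟩
      exact ⟨Or.inl ⟨n, rfl⟩, hn⟩
    · exact (hPc x hx).mono fun N hN => ⟨Or.inr hN.1, hN.2⟩
  · rintro ⟨𝓐, 𝓑, hU, hdisj, hA, hB⟩
    have key : ∀ 𝓒 𝓓 : Set (Set X), 𝓓 ⊆ Set.range H ∪ 𝓝 → Disjoint 𝓒 𝓓 → IsCover 𝓓 →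
        ¬ {n | H n ∈ 𝓒}.Infinite := by
      intro 𝓒 𝓓 hsub hd hcov hinf
      obtain ⟨p, hpP, hp⟩ := hsurj _ hinf
      obtain ⟨D, hD, hpD⟩ := hcov p
      rcases hsub hD with ⟨n, rfl⟩ | hDN
      · exact Set.disjoint_left.1 hd ((hp n).1 hpD) hD
      · exact Set.disjoint_left.1 (hPN D hDN) hpD hpP
    have h1 := key 𝓐 𝓑 (hU ▸ Set.subset_union_right) hdisj hB
    have h2 := key 𝓑 𝓐 (hU ▸ Set.subset_union_left) hdisj.symm hA
    rw [Set.not_infinite] at h1 h2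
    refine Set.infinite_univ (α := ℕ) ((h1.union h2).subset fun n _ => ?_)
    have : H n ∈ 𝓐 ∪ 𝓑 := hU ▸ Or.inl ⟨n, rfl⟩
    exact this

/-! ### Countable powers of discrete spaces. -/

/-- The countable power of a discrete space with at least two points has an unsplittable
`ω`-fold closed cover. -/
theorem exists_isUnsplittableOmegaFoldClosedCover_pi {α : Type*} [TopologicalSpace α]
    [DiscreteTopology α] [Nontrivial α] :
    ∃ 𝓗 : Set (Set (ℕ → α)), IsUnsplittableOmegaFoldClosedCover 𝓗 := by
  classical
  obtain ⟨a, b, hab⟩ := exists_pair_ne α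
  set P : Set (ℕ → α) := {f | {n | f n ≠ a}.Infinite} with hPdef
  -- The extra sets are pairs `{f, g}` outside `P`; an infinite supply of `g` puts each `f ∉ P` in
  -- infinitely many of them.
  have hPc : Pᶜ.Infinite := by
    refine (Set.infinite_range_of_injective
      (f := fun n : ℕ => Function.update (fun _ => a) n b) ?_).mono ?_
    · intro m n hmn
      by_contra hne
      have := congrFun hmn m
      simp [Function.update_of_ne hne] at this
      exact hab this.symm
    · rintro _ ⟨n, rfl⟩ h
      refine h ((Set.finite_singleton n).subset fun m hm => ?_)
      by_contra hne
      exact hm (Function.update_of_ne hne _ _)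
  refine ⟨_, isUnsplittableOmegaFoldClosedCover_range_union
    (H := fun n => {f : ℕ → α | f n ≠ a})
    (𝓝 := {N | ∃ f ∉ P, ∃ g ∉ P, N = {f, g}}) (P := P) ?_ ?_ ?_ ?_ ?_ ?_⟩
  · exact fun n => IsClosed.preimage (f := fun f : ℕ → α => f n) (continuous_apply n)
      (isClosed_discrete ({a}ᶜ : Set α))
  · rintro _ ⟨f, -, g, -, rfl⟩
    exact (Set.toFinite _).isClosed
  · rintro _ ⟨f, hf, g, hg, rfl⟩
    rw [Set.disjoint_left]
    rintro x (rfl | rfl)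
    exacts [hf, hg]
  · intro S hS
    refine ⟨fun n => if n ∈ S then b else a, ?_, fun n => ?_⟩
    · refine hS.mono fun n hn => ?_
      simpa [hn] using hab.symm
    · by_cases hn : n ∈ S <;> simp [hn, hab.symm]
  · exact fun p hp => hp
  · intro f hf
    have hinj : Function.Injective fun g => ({f, g} : Set (ℕ → α)) := by
      intro g g' h
      change ({f, g} : Set (ℕ → α)) = {f, g'} at h
      have h1 : g ∈ ({f, g'} : Set (ℕ → α)) := h ▸ Or.inr rfl
      have h2 : g' ∈ ({f, g} : Set (ℕ → α)) := h.symm ▸ Or.inr rfl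
      rcases h1 with rfl | h1
      · rcases h2 with h2 | h2 <;> exact h2.symm
      · exact h1
    refine (hPc.image hinj.injOn).mono ?_
    rintro _ ⟨g, hg, rfl⟩
    exact ⟨⟨f, hf, g, hg, rfl⟩, Or.inl rfl⟩

/-! ### Decimals with small digits. -/

/-- The real number `∑ dᵢ 10⁻ⁱ` with integer digits `dᵢ`. -/
noncomputable def decimalSum (d : ℕ → ℤ) : ℝ := ∑' i, (d i : ℝ) * (1 / 10) ^ i

theorem summable_decimal {d : ℕ → ℤ} {M : ℝ} (hd : ∀ i, |(d i : ℝ)| ≤ M) :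
    Summable fun i => (d i : ℝ) * (1 / 10 : ℝ) ^ i := by
  refine Summable.of_norm_bounded (g := fun i => M * (1 / 10 : ℝ) ^ i)
    ((summable_geometric_of_lt_one (by norm_num) (by norm_num)).mul_left M) fun i => ?_
  rw [norm_mul, norm_pow, Real.norm_eq_abs, Real.norm_eq_abs,
    abs_of_nonneg (by norm_num : (0 : ℝ) ≤ 1 / 10)]
  exact mul_le_mul_of_nonneg_right (hd i) (by positivity)

/-- A first nonzero digit at place `n` contributes at least `10⁻ⁿ`, while the tail is at most `3 ·
10⁻ⁿ⁻¹ / (1 - 1/10) = 10⁻ⁿ / 3`. The bound 3 is what a difference of two expressions `x + y - z` in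
digits 0 and 1 can reach. -/
theorem eq_zero_of_decimalSum_eq_zero {d : ℕ → ℤ} (hd : ∀ i, |(d i : ℝ)| ≤ 3)
    (h : decimalSum d = 0) : d = 0 := by
  funext n
  induction n using Nat.strong_induction_on with
  | _ n ih =>
    have hs := summable_decimal hd
    have hsplit := hs.sum_add_tsum_nat_add (n + 1)
    have hz : ∑ i ∈ Finset.range n, (d i : ℝ) * (1 / 10 : ℝ) ^ i = 0 :=
      Finset.sum_eq_zero fun i hi => by simp [ih i (Finset.mem_range.1 hi)]
    rw [Finset.sum_range_succ, hz, zero_add] at hsplit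
    have hg : HasSum (fun i : ℕ => 3 * (1 / 10 : ℝ) ^ (n + 1) * (1 / 10 : ℝ) ^ i)
        (3 * (1 / 10 : ℝ) ^ (n + 1) * (1 - 1 / 10)⁻¹) :=
      (hasSum_geometric_of_lt_one (by norm_num) (by norm_num)).mul_left _
    have htail := tsum_of_norm_bounded (f := fun i => (d (i + (n + 1)) : ℝ) *
      (1 / 10 : ℝ) ^ (i + (n + 1))) hg fun i => by
        rw [norm_mul, norm_pow, Real.norm_eq_abs, Real.norm_eq_abs,
          abs_of_nonneg (by norm_num : (0 : ℝ) ≤ 1 / 10), pow_add, mul_assoc,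
          mul_comm ((1 / 10 : ℝ) ^ (n + 1))]
        exact mul_le_mul_of_nonneg_right (hd _) (by positivity)
    have hsum : ∑' i, (d i : ℝ) * (1 / 10 : ℝ) ^ i = 0 := h
    rw [hsum] at hsplit
    have htail_eq := eq_neg_of_add_eq_zero_right hsplit
    rw [htail_eq, norm_neg, norm_mul, norm_pow, Real.norm_eq_abs, Real.norm_eq_abs,
      abs_of_nonneg (by norm_num : (0 : ℝ) ≤ 1 / 10), pow_succ] at htail
    have hpos : (0 : ℝ) < (1 / 10) ^ n := by positivity
    have hlt : |(d n : ℝ)| < 1 := by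
      by_contra hge
      push Not at hge
      nlinarith
    have hlt' : |d n| < 1 := by exact_mod_cast hlt
    exact Int.abs_lt_one_iff.1 hlt'

/-- The value of a `0`-`1` digit. -/
def boolDigit (b : Bool) : ℤ := if b then 1 else 0

theorem boolDigit_mem (b : Bool) : 0 ≤ boolDigit b ∧ boolDigit b ≤ 1 := by
  cases b <;> simp [boolDigit]

theorem abs_boolDigit_le (b : Bool) : |(boolDigit b : ℝ)| ≤ 1 := by
  cases b <;> simp [boolDigit]

theorem boolDigit_eq_one {b : Bool} : boolDigit b = 1 ↔ b = true := by
  cases b <;> simp [boolDigit]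

/-- The embedding of the Cantor space into the reals as decimals with digits `0` and `1`. -/
noncomputable def cantorReal (x : ℕ → Bool) : ℝ := decimalSum fun i => boolDigit (x i)

theorem hasSum_cantorReal (x : ℕ → Bool) :
    HasSum (fun i => (boolDigit (x i) : ℝ) * (1 / 10 : ℝ) ^ i) (cantorReal x) :=
  (summable_decimal (d := fun i => boolDigit (x i)) fun i => abs_boolDigit_le (x i)).hasSum

/-- A linear relation between points of the Cantor set holds digitwise. -/
theorem digits_eq_of_cantorReal {x y z u v w : ℕ → Bool}
    (h : cantorReal x + cantorReal y - cantorReal z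
      = cantorReal u + cantorReal v - cantorReal w) (i : ℕ) :
    boolDigit (x i) + boolDigit (y i) - boolDigit (z i)
      = boolDigit (u i) + boolDigit (v i) - boolDigit (w i) := by
  have hs := hasSum_cantorReal
  have hd := (((hs x).add (hs y)).sub (hs z)).sub (((hs u).add (hs v)).sub (hs w))
  rw [h, sub_self] at hd
  have hzero := eq_zero_of_decimalSum_eq_zero
    (d := fun i => boolDigit (x i) + boolDigit (y i) - boolDigit (z i)
      - (boolDigit (u i) + boolDigit (v i) - boolDigit (w i))) (fun i => ?_) ?_
  · exact sub_eq_zero.1 (congrFun hzero i)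
  · have hx := boolDigit_mem (x i)
    have hy := boolDigit_mem (y i)
    have hz := boolDigit_mem (z i)
    have hu := boolDigit_mem (u i)
    have hv := boolDigit_mem (v i)
    have hw := boolDigit_mem (w i)
    have : |boolDigit (x i) + boolDigit (y i) - boolDigit (z i)
      - (boolDigit (u i) + boolDigit (v i) - boolDigit (w i))| ≤ 3 := by
      rw [abs_le]; omega
    exact_mod_cast this
  · refine Eq.trans (tsum_congr fun i => ?_) hd.tsum_eq
    push_cast
    ring

theorem cantorReal_injective : Function.Injective cantorReal := by
  intro x y h
  funext i
  have := digits_eq_of_cantorReal (x := x) (y := x) (z := x) (u := y) (v := x) (w := x)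
    (by rw [h]) i
  revert this
  cases x i <;> cases y i <;> simp [boolDigit]

theorem continuous_cantorReal : Continuous cantorReal := by
  refine continuous_tsum (u := fun i => (1 / 10 : ℝ) ^ i) (fun i => ?_)
    (summable_geometric_of_lt_one (by norm_num) (by norm_num)) fun i x => ?_
  · exact (((continuous_of_discreteTopology (f := fun b : Bool => (boolDigit b : ℝ))).comp
      (continuous_apply i)).mul continuous_const)
  · rw [norm_mul, norm_pow, Real.norm_eq_abs, Real.norm_eq_abs,
      abs_of_nonneg (by norm_num : (0 : ℝ) ≤ 1 / 10)]
    exact mul_le_of_le_one_left (by positivity) (abs_boolDigit_le _)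

/-! ### Translates of the Cantor set. -/

/-- The finite supremum of `K` moves with the translation; hence different shifts count as different
members of the cover. -/
theorem translate_injective_of_isCompact {K : Set ℝ} (hK : IsCompact K) (hne : K.Nonempty) :
    Function.Injective fun t : ℝ => (fun y : ℝ => y + t) '' K := by
  intro s t hst
  have h : ∀ t : ℝ, sSup ((fun y : ℝ => y + t) '' K) = sSup K + t := fun t =>
    ((OrderIso.addRight t).map_csSup' hne hK.bddAbove).symm
  have := congrArg sSup hst
  simp only [h] at this
  linarith

/-- Outside the points with infinitely many nonzero digits, there are infinitely many translates
of the Cantor set through `x` that contain no such point. -/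
theorem infinite_setOf_translates_avoiding {P : Set ℝ}
    (hPdef : P = cantorReal '' {x | {n | x n = true}.Infinite}) {x : ℝ} (hx : x ∉ P) :
    {N : Set ℝ | ((∃ t : ℝ, N = (fun y : ℝ => y + t) '' Set.range cantorReal) ∧ Disjoint N P)
      ∧ x ∈ N}.Infinite := by
  -- The translates through `x` are `K + (x - c)` with `c ∈ K`. Fixing the first `k` digits of `c`
  -- and making it eventually 1 still leaves infinitely many choices.
  suffices ∃ (k : ℕ) (v : Bool), ∀ c : ℕ → Bool, (∀ j < k, c j = v) →
      {n | c n = false}.Finite → ∀ p c' : ℕ → Bool, {n | p n = true}.Infinite →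
      cantorReal c' + (x - cantorReal c) ≠ cantorReal p by
    obtain ⟨k, v, hkv⟩ := this
    let c : ℕ → ℕ → Bool := fun N j => if j < k then v else decide (k + N ≤ j)
    have hc : Function.Injective c := by
      have key : ∀ {M N : ℕ}, c M = c N → M ≤ N := by
        intro M N h
        have := congrFun h (k + N)
        simpa [c] using this
      exact fun M N h => le_antisymm (key h) (key h.symm)
    have hinj := (translate_injective_of_isCompact (isCompact_range continuous_cantorReal)
      (Set.range_nonempty _)).comp (((sub_right_injective (b := x)).comp
        cantorReal_injective).comp hc)
    refine (Set.infinite_range_of_injective hinj).mono ?_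
    rintro _ ⟨N, rfl⟩
    refine ⟨⟨⟨_, rfl⟩, ?_⟩, ⟨_, ⟨c N, rfl⟩, by simp⟩⟩
    rw [Set.disjoint_left]
    rintro _ ⟨_, ⟨c', rfl⟩, rfl⟩ hP
    rw [hPdef] at hP
    obtain ⟨p, hp, hpe⟩ := hP
    refine hkv (c N) (fun j hj => by simp [c, hj]) ?_ p c' hp hpe.symm
    refine (Set.finite_lt_nat (k + N)).subset fun j hj => ?_
    by_contra hge
    have h1 : ¬ j < k + N := hge
    have h2 : ¬ j < k := by omega
    exact h1 (by simpa [c, h2] using hj)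
  by_cases hxC : x ∈ Set.range cantorReal
  · obtain ⟨q, rfl⟩ := hxC
    refine ⟨0, true, fun c _ hc p c' hp h => ?_⟩
    have hq : {n | q n = true}.Finite := by
      rw [← Set.not_infinite]
      intro hq
      exact hx (hPdef ▸ ⟨q, hq, rfl⟩)
    -- Digitwise `c' + q = p + c`: where `p` and `c` are both 1, so is `q`. Hence `p` would have
    -- only finitely many ones.
    refine hp ((hc.union hq).subset fun n hn => ?_)
    have hd := digits_eq_of_cantorReal (x := c') (y := q) (z := c) (u := p) (v := c) (w := c)
      (by linarith) n
    have hn' : p n = true := hn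
    show c n = false ∨ q n = true
    revert hd
    rw [hn']
    cases c n <;> cases q n <;> cases c' n <;> simp [boolDigit]
  · by_cases hrep : ∃ a b d : ℕ → Bool, x = cantorReal a + cantorReal b - cantorReal d
    · obtain ⟨a, b, d, rfl⟩ := hrep
      -- Since `x ∉ K`, some digit of `a + b - d` is 2 or -1. Now `p + c - c' = 2` forces digit 1 in
      -- `c`, and `-1` forces 0, so prescribing the opposite digit of `c` at `i` makes the translate
      -- miss `P`.
      have hi : ∃ i, boolDigit (a i) + boolDigit (b i) - boolDigit (d i) = 2 ∨
          boolDigit (a i) + boolDigit (b i) - boolDigit (d i) = -1 := by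
        by_contra! hcon
        refine hxC ⟨fun i => decide
          (boolDigit (a i) + boolDigit (b i) - boolDigit (d i) = 1), ?_⟩
        refine (hasSum_cantorReal _).unique ?_
        have hsum := ((hasSum_cantorReal a).add (hasSum_cantorReal b)).sub (hasSum_cantorReal d)
        refine (congrArg (fun f => HasSum f _) (funext fun i => ?_)).mp hsum
        have hi := hcon i
        revert hi
        cases a i <;> cases b i <;> cases d i <;> simp [boolDigit]
      obtain ⟨i, hi⟩ := hi
      have hkey : ∀ c p c' : ℕ → Bool,
          cantorReal c' + (cantorReal a + cantorReal b - cantorReal d - cantorReal c)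
            = cantorReal p →
          boolDigit (a i) + boolDigit (b i) - boolDigit (d i)
            = boolDigit (p i) + boolDigit (c i) - boolDigit (c' i) := fun c p c' h =>
        digits_eq_of_cantorReal (by linarith) i
      rcases hi with hi | hi
      · refine ⟨i + 1, false, fun c hc _ p c' _ h => ?_⟩
        have := hkey c p c' h
        rw [hi, hc i (Nat.lt_succ_self i)] at this
        revert this
        cases p i <;> cases c' i <;> simp [boolDigit]
      · refine ⟨i + 1, true, fun c hc _ p c' _ h => ?_⟩
        have := hkey c p c' h
        rw [hi, hc i (Nat.lt_succ_self i)] at this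
        revert this
        cases p i <;> cases c' i <;> simp [boolDigit]
    · refine ⟨0, true, fun c _ _ p c' _ h => hrep ⟨p, c, c', by linarith⟩⟩

/-- The compact set of decimals with digits `0` and `1` has translates forming an unsplittable
`ω`-fold cover of the line. -/
theorem exists_isUnsplittableOmegaFoldClosedCover_translates :
    ∃ (K : Set ℝ) (𝓗 : Set (Set ℝ)), IsCompact K ∧
      (∀ H ∈ 𝓗, ∃ t : ℝ, H = (fun y : ℝ => y + t) '' K) ∧
      IsUnsplittableOmegaFoldClosedCover 𝓗 := by
  classical
  have hK : IsCompact (Set.range cantorReal) := isCompact_range continuous_cantorReal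
  have hcl : ∀ t : ℝ, IsClosed ((fun y : ℝ => y + t) '' Set.range cantorReal) := fun t =>
    (hK.image (continuous_add_const t)).isClosed
  -- `cantorReal (a n)` is `10⁻ⁿ`.
  let a : ℕ → ℕ → Bool := fun n => Function.update (fun _ => false) n true
  let H : ℕ → Set ℝ := fun n => (fun y : ℝ => y + cantorReal (a n)) '' Set.range cantorReal
  have hzero : cantorReal (fun _ => false) = 0 := by
    simp [cantorReal, decimalSum, boolDigit]
  have htrace : ∀ (p : ℕ → Bool) (n : ℕ), cantorReal p ∈ H n ↔ p n = true := by
    intro p n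
    constructor
    · rintro ⟨_, ⟨c, rfl⟩, h⟩
      have := digits_eq_of_cantorReal (x := c) (y := a n) (z := fun _ => false) (u := p)
        (v := fun _ => false) (w := fun _ => false)
        (by rw [hzero]; simp only at h; linarith) n
      simp only [a, Function.update_self] at this
      revert this
      cases c n <;> cases p n <;> simp [boolDigit]
    · intro hp
      refine ⟨_, ⟨Function.update p n false, rfl⟩, ?_⟩
      refine ((hasSum_cantorReal _).add (hasSum_cantorReal (a n))).unique ?_
      convert hasSum_cantorReal p using 2 with i
      by_cases hi : i = n
      · subst hi
        simp [a, hp, boolDigit]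
      · simp [a, Function.update_of_ne hi, boolDigit]
  refine ⟨Set.range cantorReal, _, hK, ?_, isUnsplittableOmegaFoldClosedCover_range_union
    (H := H)
    (𝓝 := {N | (∃ t : ℝ, N = (fun y : ℝ => y + t) '' Set.range cantorReal) ∧
      Disjoint N (cantorReal '' {x | {n | x n = true}.Infinite})})
    (P := cantorReal '' {x | {n | x n = true}.Infinite}) ?_ ?_ ?_ ?_ ?_ ?_⟩
  · rintro _ (⟨n, rfl⟩ | h)
    exacts [⟨_, rfl⟩, h.1]
  · exact fun n => hcl _
  · rintro _ ⟨⟨t, rfl⟩, -⟩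
    exact hcl t
  · exact fun N hN => hN.2
  · intro S hS
    refine ⟨_, ⟨fun n => decide (n ∈ S), ?_, rfl⟩, fun n => ?_⟩
    · simpa using hS
    · rw [htrace]
      simp
  · rintro _ ⟨p, hp, rfl⟩
    simpa only [htrace, Set.mem_ofPred_eq] using hp
  · exact fun x hx => infinite_setOf_translates_avoiding rfl hx

theorem corollary6p2 :
    (∃ (K : Set ℝ) (𝓗 : Set (Set ℝ)), IsCompact K ∧
      (∀ H ∈ 𝓗, ∃ t : ℝ, H = (fun y : ℝ => y + t) '' K) ∧
      IsUnsplittableOmegaFoldClosedCover 𝓗) ∧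
    (∃ 𝓗 : Set (Set (ℕ → ℕ)), IsUnsplittableOmegaFoldClosedCover 𝓗) ∧
    (∃ 𝓗 : Set (Set (ℕ → Bool)), IsUnsplittableOmegaFoldClosedCover 𝓗) :=
  ⟨exists_isUnsplittableOmegaFoldClosedCover_translates,
    exists_isUnsplittableOmegaFoldClosedCover_pi, exists_isUnsplittableOmegaFoldClosedCover_pi⟩
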